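/- Parrondo's coin-tossing games are as follows. In game $A$ a fair coin is tossed. In game $B$, with integer parameter $r\ge 3$ and real parameter $\rho\in[0,1)$, a coin with probability of heads $p_0=\rho^{r-1}/(1+\rho^{r-1})$ is tossed if the current capital (an integer) is a multiple of $r$, and a coin with probability of heads $p_1=1/(1+\rho)$ is tossed otherwise. In either game the player wins one unit with heads and loses one unit with tails. For a finite nonempty word $\Gamma$ in the letters $A,B$, let $\mu(r,\rho,\Gamma)$ denote the rate of profit when the pattern $\Gamma$ is played repeatedly ad infinitum, i.e. the (constant) almost sure limit of $(X_n-X_0)/n$ as $n\to\infty$, where $X_n$ is the capital after $n$ games and $X_0$ is the (deterministic) initial capital. For each integer $r\ge3$ let $s_r:=\lfloor\log_2 r\rfloor-1$, and let an integer initial capital $x_r$ be given, which is even if $r$ is even. Then for every $r\ge 3$ the rate of profit $\mu(r,0,(AB)^{s_r}B^{r-2})$ with initial capital $x_r$ exists, and $$1-\mu\bigl(r,0,(AB)^{s_r}B^{r-2}\bigr)\sim\frac{2s_r}{r}\qquad\text{as } r\to\infty.$$ -/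

import Mathlib

open Filter Topology MeasureTheory Asymptotics

namespace Parrondo

/-- The two coin-tossing games. -/
inductive Game where
  | A
  | B

/-- The probability of heads of the coin that is tossed in the given game when the current capital
is `x`. Game `A` uses a fair coin. Game `B` uses the coin with
`p₀ = ρ ^ (r - 1) / (1 + ρ ^ (r - 1))` if the capital is a multiple of `r`, and the coin with
`p₁ = 1 / (1 + ρ)` otherwise. -/
noncomputable def headsProb (r : ℕ) (ρ : ℝ) (g : Game) (x : ℤ) : ℝ :=
  match g with
  | Game.A => 1 / 2
  | Game.B => if (r : ℤ) ∣ x then ρ ^ (r - 1) / (1 + ρ ^ (r - 1)) else 1 / (1 + ρ)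

/-- The game played at turn `n + 1` when the (nonempty) pattern `Γ` is repeated ad infinitum. The
default value of `getD` is only reached for the empty pattern. -/
def gameAt (Γ : List Game) (n : ℕ) : Game :=
  Γ.getD (n % Γ.length) Game.A

/-- The law of a sequence of independent random variables, each uniform on `[0, 1]`. -/
noncomputable def uniformSeq : Measure (ℕ → unitInterval) :=
  Measure.infinitePi fun _ : ℕ => (volume : Measure unitInterval)

/-- The player's capital after `n` turns, with initial capital `x₀`, when the pattern `Γ` is
repeated ad infinitum. The `p`-coin of turn `n + 1` shows heads if `ω n < p`, which has probability
`p` for `p ∈ [0, 1]`; the player wins one unit with heads and loses one unit with tails. -/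
noncomputable def capital (r : ℕ) (ρ : ℝ) (Γ : List Game) (x₀ : ℤ) (ω : ℕ → unitInterval) : ℕ → ℤ
  | 0 => x₀
  | n + 1 =>
    if (ω n : ℝ) < headsProb r ρ (gameAt Γ n) (capital r ρ Γ x₀ ω n) then
      capital r ρ Γ x₀ ω n + 1
    else
      capital r ρ Γ x₀ ω n - 1

/-- `HasRateOfProfit r ρ Γ x₀ m` says that the rate of profit `μ(r, ρ, Γ)` with initial capital
`x₀` exists and equals `m`: the cumulative profit per game played converges to the constant `m`
almost surely. -/
def HasRateOfProfit (r : ℕ) (ρ : ℝ) (Γ : List Game) (x₀ : ℤ) (m : ℝ) : Prop :=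
  ∀ᵐ ω ∂uniformSeq,
    Tendsto (fun n : ℕ => ((capital r ρ Γ x₀ ω n : ℝ) - (x₀ : ℝ)) / (n : ℝ)) atTop (𝓝 m)

/-- The rate of profit is unique when it exists. -/
theorem HasRateOfProfit.unique {r : ℕ} {ρ : ℝ} {Γ : List Game} {x₀ : ℤ} {m m' : ℝ}
    (h : HasRateOfProfit r ρ Γ x₀ m) (h' : HasRateOfProfit r ρ Γ x₀ m') : m = m' := by
  have : IsProbabilityMeasure uniformSeq := by
    unfold uniformSeq
    infer_instance
  obtain ⟨ω, h1, h2⟩ := (Filter.Eventually.and h h').exists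
  exact tendsto_nhds_unique h1 h2

/-- The pattern `(AB)^s B^(r-2)`. -/
def pattern (r s : ℕ) : List Game :=
  (List.replicate s [Game.A, Game.B]).flatten ++ List.replicate (r - 2) Game.B

/-- `s_r = ⌊log₂ r⌋ - 1`, a nonnegative integer for `r ≥ 2`. -/
noncomputable def sFun (r : ℕ) : ℕ := ⌊Real.logb 2 (r : ℝ)⌋₊ - 1

end Parrondo

/-! ### The game played at each turn of the periodic pattern -/

namespace Parrondo

/-! At ρ = 0 game B is deterministic off a null set: it loses at multiples of r and wins elsewhere.
Starting from a multiple M of r, each pair AB adds 2 if its fair coin shows heads and nothing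
otherwise. If at least one coin shows heads, the run of r - 2 games B climbs to M + r, and any
remaining games cancel in pairs. If none does, that run only alternates between M and M - 1. With q
= 2^(-s), a period therefore gains r with probability 1 - q and -(r mod 2) with probability q. For
even r parity keeps the capital at multiples of r after the first period. For odd r a failure leads
to -1 mod r, and the next period then surely gains 1. The mean gain per period of 2s + r - 2 games
is thus r(1 - q) for even r and r(1 - q)/(1 + q) for odd r.

Almost sure convergence needs no ergodic theorem. Each gain is the mean, plus a bounded telescoping
correction, plus a multiple of `centredTails`. These last variables are orthogonal because the coins
of a period are independent of the past, so `strong_law_of_orthogonal` applies;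
`hasRateOfProfit_of_period` combines the three.

Since 2^(s_r + 1) ≤ r < 2^(s_r + 2), the product r q stays bounded while s_r → ∞ and s_r / r → 0.
Hence 1 - μ = (2 s_r + O(1)) / (r + o(r)). -/

theorem length_pattern (r s : ℕ) : (pattern r s).length = 2 * s + (r - 2) := by
  simp [pattern, mul_comm]

theorem getD_flatten_replicate_pair (s i : ℕ) (hi : i < 2 * s) (l : List Game) :
    ((List.replicate s [Game.A, Game.B]).flatten ++ l).getD i Game.A =
      if Even i then Game.A else Game.B := by
  induction s generalizing i with
  | zero => omega
  | succ s ih =>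
    match i with
    | 0 => simp [List.replicate_succ]
    | 1 => simp [List.replicate_succ]
    | i + 2 =>
      have := ih i (by omega)
      simpa [List.replicate_succ, Nat.even_add] using this

section Pattern

variable {r s : ℕ}

theorem gameAt_pattern_even (k : ℕ) {i : ℕ} (hi : i < s) :
    gameAt (pattern r s) (k * (2 * s + (r - 2)) + 2 * i) = Game.A := by
  unfold gameAt
  rw [length_pattern, Nat.mul_add_mod_of_lt (by omega), pattern,
    getD_flatten_replicate_pair _ _ (by omega)]
  simp

theorem gameAt_pattern_odd (k : ℕ) {i : ℕ} (hi : i < s) :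
    gameAt (pattern r s) (k * (2 * s + (r - 2)) + 2 * i + 1) = Game.B := by
  unfold gameAt
  rw [length_pattern, add_assoc, Nat.mul_add_mod_of_lt (by omega), pattern,
    getD_flatten_replicate_pair _ _ (by omega)]
  simp

theorem gameAt_pattern_tail (k : ℕ) {t : ℕ} (ht : t < r - 2) :
    gameAt (pattern r s) (k * (2 * s + (r - 2)) + 2 * s + t) = Game.B := by
  unfold gameAt
  rw [length_pattern, add_assoc, Nat.mul_add_mod_of_lt (by omega), pattern,
    List.getD_append_right _ _ _ _ (by simp; omega)]
  have : 2 * s + t - (List.replicate s [Game.A, Game.B]).flatten.length = t := by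
    simp; omega
  rw [this, List.getD_eq_getElem _ _ (by simpa using ht), List.getElem_replicate]

end Pattern

/-! ### Single games and runs of games B at ρ = 0 -/

section Steps

variable {r : ℕ} {Γ : List Game} {x : ℤ} {ω : ℕ → unitInterval} {n : ℕ}

theorem capital_succ_A (hg : gameAt Γ n = Game.A) :
    capital r 0 Γ x ω (n + 1) =
      if (ω n : ℝ) < 1 / 2 then capital r 0 Γ x ω n + 1 else capital r 0 Γ x ω n - 1 := by
  simp only [capital, headsProb, hg]

theorem capital_succ_B_of_dvd (hr : 2 ≤ r) (hg : gameAt Γ n = Game.B)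
    (hd : (r : ℤ) ∣ capital r 0 Γ x ω n) :
    capital r 0 Γ x ω (n + 1) = capital r 0 Γ x ω n - 1 := by
  have h0 : (0 : ℝ) ^ (r - 1) = 0 := zero_pow (by omega)
  have h1 : ¬ (ω n : ℝ) < 0 := not_lt.2 (ω n).2.1
  simp only [capital, headsProb, hg, hd, if_true, h0, zero_div, h1, if_false]

theorem capital_succ_B_of_not_dvd (hω : (ω n : ℝ) < 1) (hg : gameAt Γ n = Game.B)
    (hd : ¬ (r : ℤ) ∣ capital r 0 Γ x ω n) :
    capital r 0 Γ x ω (n + 1) = capital r 0 Γ x ω n + 1 := by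
  simp only [capital, headsProb, hg, hd, if_false, add_zero, div_one, hω, if_true]

theorem capital_succ_eq_or (r : ℕ) (ρ : ℝ) (Γ : List Game) (x : ℤ) (ω : ℕ → unitInterval)
    (n : ℕ) : capital r ρ Γ x ω (n + 1) = capital r ρ Γ x ω n + 1 ∨
      capital r ρ Γ x ω (n + 1) = capital r ρ Γ x ω n - 1 := by
  rw [capital]
  split_ifs <;> simp

theorem even_capital_sub (r : ℕ) (ρ : ℝ) (Γ : List Game) (x : ℤ) (ω : ℕ → unitInterval)
    (n : ℕ) : Even (capital r ρ Γ x ω n - x - n) := by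
  induction n with
  | zero => simp [capital]
  | succ n ih =>
    obtain ⟨c, hc⟩ := ih
    push_cast
    rcases capital_succ_eq_or r ρ Γ x ω n with h | h
    · exact ⟨c, by omega⟩
    · exact ⟨c - 1, by omega⟩

/-- A run of games `B` lets the capital climb to the next multiple of `r`. -/
theorem capital_climb (hω : ∀ n, (ω n : ℝ) < 1) {T : ℕ}
    (hg : ∀ t < T, gameAt Γ (n + t) = Game.B) {M : ℤ} (hM : (r : ℤ) ∣ M) {j : ℕ} (hj : 1 ≤ j)
    (hc : capital r 0 Γ x ω n = M + j) {t : ℕ} (ht : t ≤ T) (htr : j + t ≤ r) :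
    capital r 0 Γ x ω (n + t) = M + j + t := by
  induction t with
  | zero => simpa using hc
  | succ t ih =>
    have ih := ih (by omega) (by omega)
    have hnd : ¬ (r : ℤ) ∣ capital r 0 Γ x ω (n + t) := by
      rw [ih, add_assoc, Int.dvd_add_right hM]
      intro h
      have := Int.le_of_dvd (by omega) h
      omega
    rw [← add_assoc, capital_succ_B_of_not_dvd (hω _) (hg t (by omega)) hnd, ih]
    push_cast
    ring

/-- A run of games `B` starting at a multiple of `r` makes the capital alternate. -/
theorem capital_bounce (hr : 2 ≤ r) (hω : ∀ n, (ω n : ℝ) < 1) {T : ℕ}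
    (hg : ∀ t < T, gameAt Γ (n + t) = Game.B) (hc : (r : ℤ) ∣ capital r 0 Γ x ω n)
    {t : ℕ} (ht : t ≤ T) :
    capital r 0 Γ x ω (n + t) = capital r 0 Γ x ω n - (t % 2 : ℕ) := by
  induction t with
  | zero => simp
  | succ t ih =>
    have ih := ih (by omega)
    rcases Nat.mod_two_eq_zero_or_one t with h | h
    · rw [h] at ih
      rw [← add_assoc, capital_succ_B_of_dvd hr (hg t (by omega)) (by simpa [ih] using hc), ih]
      have : (t + 1) % 2 = 1 := by omega
      rw [this]
      simp
    · rw [h] at ih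
      have hnd : ¬ (r : ℤ) ∣ capital r 0 Γ x ω (n + t) := by
        rw [ih, dvd_sub_right hc]
        intro h
        have := Int.le_of_dvd (by omega) h
        omega
      rw [← add_assoc, capital_succ_B_of_not_dvd (hω _) (hg t (by omega)) hnd, ih]
      have : (t + 1) % 2 = 0 := by omega
      rw [this]
      simp

/-- From the `j`-th residue, enough games `B` lead to the next multiple of `r`, up to parity. -/
theorem capital_climb_bounce (hr : 2 ≤ r) (hω : ∀ n, (ω n : ℝ) < 1) {T : ℕ}
    (hg : ∀ t < T, gameAt Γ (n + t) = Game.B) {M : ℤ} (hM : (r : ℤ) ∣ M) {j : ℕ} (hj : 1 ≤ j)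
    (hjr : j ≤ r) (hc : capital r 0 Γ x ω n = M + j) (hT : r ≤ j + T) :
    capital r 0 Γ x ω (n + T) = M + r - ((j + T - r) % 2 : ℕ) := by
  have h1 := capital_climb hω hg hM hj hc (t := r - j) (by omega) (by omega)
  have h2 : capital r 0 Γ x ω (n + (r - j)) = M + r := by rw [h1]; omega
  have h3 := capital_bounce (n := n + (r - j)) (T := T - (r - j)) (x := x) hr hω
    (fun t ht => by rw [add_assoc]; exact hg _ (by omega))
    (by rw [h2]; exact dvd_add hM dvd_rfl) le_rfl
  rw [h2] at h3
  have e1 : n + (r - j) + (T - (r - j)) = n + T := by omega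
  have e2 : T - (r - j) = j + T - r := by omega
  rwa [e1, e2] at h3

end Steps

/-! ### The effect of one full period -/

section Blocks

variable {r s : ℕ} {x : ℤ} {ω : ℕ → unitInterval}

/-- The effect of `(AB)^i` on a capital that is a multiple of `r`. -/
theorem capital_AB_of_dvd (hr : 3 ≤ r) (hs : 2 * s ≤ r) (hω : ∀ n, (ω n : ℝ) < 1) (k : ℕ)
    (hd : (r : ℤ) ∣ capital r 0 (pattern r s) x ω (k * (2 * s + (r - 2)))) {i : ℕ} (hi : i ≤ s) :
    ∃ a ≤ i, capital r 0 (pattern r s) x ω (k * (2 * s + (r - 2)) + 2 * i) =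
        capital r 0 (pattern r s) x ω (k * (2 * s + (r - 2))) + 2 * a ∧
      (a = 0 ↔ ∀ j < i, 1 / 2 ≤ (ω (k * (2 * s + (r - 2)) + 2 * j) : ℝ)) := by
  induction i with
  | zero => exact ⟨0, le_rfl, by simp⟩
  | succ i ih =>
    obtain ⟨a, hai, hc, ha⟩ := ih (by omega)
    have hA := capital_succ_A (r := r) (x := x) (ω := ω) (gameAt_pattern_even (r := r) k
      (show i < s by omega))
    have hnd : ¬ (r : ℤ) ∣ capital r 0 (pattern r s) x ω
        (k * (2 * s + (r - 2)) + 2 * i + 1) := by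
      rw [hA, hc]
      split_ifs
      -- Heads: the offset 2a + 1 lies strictly between 0 and r, because a ≤ i < s and 2s ≤ r.
      · rw [add_assoc, Int.dvd_add_right hd]
        intro h
        have := Int.le_of_dvd (by omega) h
        omega
      -- Tails: the offset 2a - 1 is -1 when a = 0 and otherwise lies strictly between 0 and r.
      · rw [add_sub_assoc, Int.dvd_add_right hd]
        intro h
        rcases Nat.eq_zero_or_pos a with h0 | h0
        · subst h0
          have := Int.le_of_dvd (b := 1) (by omega) (by simpa using h)
          omega
        · have := Int.le_of_dvd (by omega) h
          omega
    have hB := capital_succ_B_of_not_dvd (hω _) (gameAt_pattern_odd (r := r) k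
      (show i < s by omega)) hnd
    rw [hA, hc] at hB
    have e : k * (2 * s + (r - 2)) + 2 * (i + 1) = k * (2 * s + (r - 2)) + 2 * i + 1 + 1 := by ring
    rw [e, hB]
    by_cases hlt : (ω (k * (2 * s + (r - 2)) + 2 * i) : ℝ) < 1 / 2
    · refine ⟨a + 1, by omega, by rw [if_pos hlt]; push_cast; ring, by omega, fun h => ?_⟩
      exact absurd (h i (by omega)) (not_le.2 hlt)
    · refine ⟨a, by omega, by rw [if_neg hlt]; ring, ?_⟩
      rw [ha]
      constructor
      · intro h j hj
        rcases Nat.lt_succ_iff_lt_or_eq.1 hj with hj | rfl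
        · exact h j hj
        · exact not_lt.1 hlt
      · exact fun h j hj => h j (by omega)

/-- `(AB)^i` leaves the capital unchanged just below a multiple of `r`. -/
theorem capital_AB_of_dvd_succ (hr : 3 ≤ r) (hω : ∀ n, (ω n : ℝ) < 1) (k : ℕ)
    (hd : (r : ℤ) ∣ capital r 0 (pattern r s) x ω (k * (2 * s + (r - 2))) + 1) {i : ℕ}
    (hi : i ≤ s) :
    capital r 0 (pattern r s) x ω (k * (2 * s + (r - 2)) + 2 * i) =
        capital r 0 (pattern r s) x ω (k * (2 * s + (r - 2))) := by
  induction i with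
  | zero => simp
  | succ i ih =>
    have hc := ih (by omega)
    have hA := capital_succ_A (r := r) (x := x) (ω := ω) (gameAt_pattern_even (r := r) k
      (show i < s by omega))
    have e : k * (2 * s + (r - 2)) + 2 * (i + 1) = k * (2 * s + (r - 2)) + 2 * i + 1 + 1 := by ring
    rw [e]
    split_ifs at hA
    · rw [capital_succ_B_of_dvd (by omega) (gameAt_pattern_odd (r := r) k
        (show i < s by omega)) (by rwa [hA, hc]), hA, hc]
      ring
    · rw [capital_succ_B_of_not_dvd (hω _) (gameAt_pattern_odd (r := r) k
        (show i < s by omega)), hA, hc]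
      · ring
      · rw [hA, hc]
        intro h
        have h2 := dvd_sub hd h
        ring_nf at h2
        have := Int.le_of_dvd (by omega) h2
        omega

theorem capital_period_of_dvd (hr : 3 ≤ r) (hs : 2 * s ≤ r) (hω : ∀ n, (ω n : ℝ) < 1) (k : ℕ)
    (hd : (r : ℤ) ∣ capital r 0 (pattern r s) x ω (k * (2 * s + (r - 2)))) :
    capital r 0 (pattern r s) x ω ((k + 1) * (2 * s + (r - 2))) =
      capital r 0 (pattern r s) x ω (k * (2 * s + (r - 2))) +
        if ∀ j < s, 1 / 2 ≤ (ω (k * (2 * s + (r - 2)) + 2 * j) : ℝ) then -((r % 2 : ℕ) : ℤ)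
        else r := by
  obtain ⟨a, has, hc, ha⟩ := capital_AB_of_dvd hr hs hω k hd le_rfl
  have e : (k + 1) * (2 * s + (r - 2)) = k * (2 * s + (r - 2)) + 2 * s + (r - 2) := by ring
  rw [e]
  split_ifs with h
  · rw [← ha] at h
    subst h
    rw [capital_bounce (by omega) hω (fun t ht => gameAt_pattern_tail k ht) (by simpa [hc] using hd)
      le_rfl, hc]
    have : (r - 2) % 2 = r % 2 := by omega
    rw [this]
    simp
    ring
  · rw [← ha] at h
    rw [capital_climb_bounce (by omega) hω (fun t ht => gameAt_pattern_tail k ht) hd (j := 2 * a)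
      (by omega) (by omega) (by rw [hc]; push_cast; rfl) (by omega)]
    -- After the climb 2a - 2 games remain, an even number, so the capital ends on the multiple
    -- itself.
    have : (2 * a + (r - 2) - r) % 2 = 0 := by omega
    rw [this]
    simp

/-- The pairs AB have no effect here; one game B then reaches the multiple of r, and the remaining r
- 3 games cancel because r is odd. -/
theorem capital_period_of_dvd_succ (hr : 3 ≤ r) (hodd : Odd r) (hω : ∀ n, (ω n : ℝ) < 1)
    (k : ℕ) (hd : (r : ℤ) ∣ capital r 0 (pattern r s) x ω (k * (2 * s + (r - 2))) + 1) :
    capital r 0 (pattern r s) x ω ((k + 1) * (2 * s + (r - 2))) =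
      capital r 0 (pattern r s) x ω (k * (2 * s + (r - 2))) + 1 := by
  have hc := capital_AB_of_dvd_succ hr hω k hd le_rfl
  have e : (k + 1) * (2 * s + (r - 2)) = k * (2 * s + (r - 2)) + 2 * s + (r - 2) := by ring
  rw [e, capital_climb_bounce (by omega) hω (fun t ht => gameAt_pattern_tail k ht)
    (M := capital r 0 (pattern r s) x ω (k * (2 * s + (r - 2))) + 1 - r) (dvd_sub hd dvd_rfl)
    (j := r - 1) (by omega) (by omega) (by rw [hc]; push_cast [show 1 ≤ r by omega]; ring)
    (by omega)]
  obtain ⟨m, hm⟩ := hodd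
  have : (r - 1 + (r - 2) - r) % 2 = 0 := by omega
  rw [this]
  push_cast
  ring

/-- After each full period the capital is `0` or `-1` modulo `r`. -/
theorem dvd_or_dvd_succ_capital_period (hr : 3 ≤ r) (hω : ∀ n, (ω n : ℝ) < 1) (k : ℕ) :
    (r : ℤ) ∣ capital r 0 (pattern r s) x ω ((k + 1) * (2 * s + (r - 2))) ∨
      (r : ℤ) ∣ capital r 0 (pattern r s) x ω ((k + 1) * (2 * s + (r - 2))) + 1 := by
  have e : (k + 1) * (2 * s + (r - 2)) = k * (2 * s + (r - 2)) + 2 * s + (r - 2) := by ring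
  rw [e]
  set c := capital r 0 (pattern r s) x ω (k * (2 * s + (r - 2)) + 2 * s) with hc
  have hg : ∀ t < r - 2, gameAt (pattern r s) (k * (2 * s + (r - 2)) + 2 * s + t) = Game.B :=
    fun t ht => gameAt_pattern_tail k ht
  have key : ∀ (M : ℤ) (b : ℕ), (r : ℤ) ∣ M →
      (r : ℤ) ∣ M - (b % 2 : ℕ) ∨ (r : ℤ) ∣ M - (b % 2 : ℕ) + 1 := by
    intro M b hM
    rcases Nat.mod_two_eq_zero_or_one b with h | h <;> simp [h, hM]
  have hmod : ((c % r).toNat : ℤ) = c % r := Int.toNat_of_nonneg (Int.emod_nonneg _ (by omega))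
  have hlt : c % r < r := Int.emod_lt_of_pos _ (by omega)
  have hM : (r : ℤ) ∣ c - c % r := Int.dvd_self_sub_emod
  have hcj : c = (c - c % r) + ((c % r).toNat : ℕ) := by rw [hmod]; ring
  -- Residue 0 alternates from the outset, residue 1 stops exactly one short of the next multiple
  -- after r - 2 wins, and any larger residue reaches that multiple and then alternates.
  rcases Nat.lt_or_ge (c % r).toNat 2 with h2 | h2
  · rcases Nat.lt_or_ge (c % r).toNat 1 with h1 | h1
    · have hd : (r : ℤ) ∣ c := Int.dvd_of_emod_eq_zero (by omega)
      rw [capital_bounce (by omega) hω hg hd le_rfl]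
      exact key _ _ hd
    · right
      rw [capital_climb hω hg hM h1 hcj le_rfl (by omega)]
      have : c - c % r + ((c % r).toNat : ℕ) + ((r - 2 : ℕ) : ℤ) + 1 = (c - c % r) + r := by omega
      rw [this]
      exact dvd_add hM dvd_rfl
  · rw [capital_climb_bounce (by omega) hω hg hM (by omega) (by omega) hcj (by omega)]
    exact key _ _ (dvd_add hM dvd_rfl)

/-- For even r the period length is even, so the capital at period ends has the parity of the
initial capital; this rules out -1 mod r. -/
theorem dvd_capital_period_of_even (hr : 3 ≤ r) (heven : Even r) (hx : Even x)
    (hω : ∀ n, (ω n : ℝ) < 1) (k : ℕ) :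
    (r : ℤ) ∣ capital r 0 (pattern r s) x ω ((k + 1) * (2 * s + (r - 2))) := by
  refine (dvd_or_dvd_succ_capital_period hr hω k).resolve_right fun h => ?_
  have h2 : (2 : ℤ) ∣ capital r 0 (pattern r s) x ω ((k + 1) * (2 * s + (r - 2))) + 1 :=
    (by exact_mod_cast heven.two_dvd : (2 : ℤ) ∣ r).trans h
  obtain ⟨a, ha⟩ := even_capital_sub r 0 (pattern r s) x ω ((k + 1) * (2 * s + (r - 2)))
  obtain ⟨b, hb⟩ := hx
  have : Even ((k + 1) * (2 * s + (r - 2))) :=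
    ((even_two.mul_right s).add ((Nat.even_sub (by omega)).2 (by simp [heven]))).mul_left _
  obtain ⟨d, hd⟩ := this
  omega

end Blocks

/-! ### A strong law for bounded orthogonal variables -/

section StrongLaw

theorem abs_sub_le_of_bounded_steps {u : ℕ → ℝ} {K : ℝ} (hK : ∀ n, |u (n + 1) - u n| ≤ K)
    {m n : ℕ} (hmn : m ≤ n) : |u n - u m| ≤ K * (n - m : ℕ) := by
  induction n, hmn using Nat.le_induction with
  | base => simp
  | succ n hmn ih =>
    rw [Nat.succ_sub hmn]
    calc |u (n + 1) - u m| = |(u (n + 1) - u n) + (u n - u m)| := by ring_nf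
      _ ≤ |u (n + 1) - u n| + |u n - u m| := abs_add_le _ _
      _ ≤ K + K * (n - m : ℕ) := add_le_add (hK n) ih
      _ = _ := by push_cast; ring

/-- Interpolation from a subsequence: bounded increments control the error between `t n` and `n`. It
serves both for squares in the strong law and for multiples of the period length. -/
theorem tendsto_div_of_bounded_steps {u : ℕ → ℝ} {K : ℝ} (hK : ∀ n, |u (n + 1) - u n| ≤ K)
    {t : ℕ → ℕ} (ht : ∀ n, t n ≤ n) (ht0 : ∀ᶠ n in atTop, 0 < t n)
    (h1 : Tendsto (fun n => u (t n) / t n) atTop (𝓝 0))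
    (h2 : Tendsto (fun n : ℕ => ((n - t n : ℕ) : ℝ) / n) atTop (𝓝 0)) :
    Tendsto (fun n : ℕ => u n / n) atTop (𝓝 0) := by
  have h3 : Tendsto (fun n : ℕ => |u (t n) / t n| + K * (((n - t n : ℕ) : ℝ) / n)) atTop (𝓝 0) := by
    simpa using h1.abs.add (h2.const_mul K)
  refine squeeze_zero_norm' ?_ h3
  filter_upwards [ht0] with n hn
  have hn' : (0 : ℝ) < n := by exact_mod_cast hn.trans_le (ht n)
  have htn : (0 : ℝ) < t n := by exact_mod_cast hn
  have hle : (t n : ℝ) ≤ n := by exact_mod_cast ht n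
  rw [Real.norm_eq_abs, abs_div, abs_of_pos hn', abs_div, abs_of_pos htn]
  have h4 : |u n| ≤ |u (t n)| + K * (n - t n : ℕ) := by
    have := abs_sub_le_of_bounded_steps hK (ht n)
    have := abs_sub_abs_le_abs_sub (u n) (u (t n))
    linarith
  calc |u n| / n ≤ (|u (t n)| + K * (n - t n : ℕ)) / n := by gcongr
    _ = |u (t n)| / n + K * (((n - t n : ℕ) : ℝ) / n) := by ring
    _ ≤ |u (t n)| / t n + K * (((n - t n : ℕ) : ℝ) / n) := by gcongr

theorem tendsto_natSqrt_atTop : Tendsto Nat.sqrt atTop atTop :=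
  tendsto_atTop_atTop.2 fun b => ⟨b * b, fun _ h => Nat.le_sqrt.2 h⟩

variable {Ω : Type*} [MeasurableSpace Ω] {P : Measure Ω} [IsProbabilityMeasure P]

/-- Orthogonality removes the cross terms, and each diagonal term is at most 1. -/
theorem integral_sq_sum_le {D : ℕ → Ω → ℝ} (hm : ∀ k, Measurable (D k))
    (hb : ∀ k ω, |D k ω| ≤ 1) (ho : ∀ i j, i < j → ∫ ω, D i ω * D j ω ∂P = 0) (n : ℕ) :
    ∫ ω, (∑ i ∈ Finset.range n, D i ω) ^ 2 ∂P ≤ n := by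
  have hint : ∀ i j, Integrable (fun ω => D i ω * D j ω) P := fun i j =>
    Integrable.of_bound ((hm i).mul (hm j)).aestronglyMeasurable 1 (ae_of_all _ fun ω => by
      rw [norm_mul]
      exact mul_le_one₀ (hb i ω) (norm_nonneg _) (hb j ω))
  simp_rw [sq, Finset.sum_mul_sum]
  rw [integral_finsetSum _ fun i _ => integrable_finsetSum _ fun j _ => hint i j]
  simp_rw [integral_finsetSum (Finset.range n) fun j _ => hint _ j]
  calc ∑ i ∈ Finset.range n, ∑ j ∈ Finset.range n, ∫ ω, D i ω * D j ω ∂P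
      ≤ ∑ i ∈ Finset.range n, ∑ j ∈ Finset.range n, if i = j then (1 : ℝ) else 0 := by
        gcongr with i _ j _
        split_ifs with h
        · calc ∫ ω, D i ω * D j ω ∂P ≤ ∫ _, (1 : ℝ) ∂P :=
              integral_mono (hint i j) (integrable_const _) fun ω => by
                refine (le_abs_self _).trans ?_
                rw [abs_mul]
                exact mul_le_one₀ (hb i ω) (abs_nonneg _) (hb j ω)
            _ = 1 := by simp
        · rcases lt_or_gt_of_ne h with h | h
          · exact (ho i j h).le
          · simp_rw [mul_comm (D i _)]
            exact (ho j i h).le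
    _ = ∑ i ∈ Finset.range n, (1 : ℝ) :=
        Finset.sum_congr rfl fun i hi => by rw [Finset.sum_ite_eq, if_pos hi]
    _ = n := by simp

/-- Strong law of large numbers for bounded orthogonal random variables. -/
theorem strong_law_of_orthogonal {D : ℕ → Ω → ℝ} (hm : ∀ k, Measurable (D k))
    (hb : ∀ k ω, |D k ω| ≤ 1) (ho : ∀ i j, i < j → ∫ ω, D i ω * D j ω ∂P = 0) :
    ∀ᵐ ω ∂P, Tendsto (fun n : ℕ => (∑ i ∈ Finset.range n, D i ω) / n) atTop (𝓝 0) := by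
  have hSm : ∀ n, Measurable fun ω => ∑ i ∈ Finset.range n, D i ω := fun n =>
    Finset.measurable_fun_sum _ fun i _ => hm i
  have hSb : ∀ n ω, |∑ i ∈ Finset.range n, D i ω| ≤ n := fun n ω =>
    (Finset.abs_sum_le_sum_abs _ _).trans ((Finset.sum_le_sum fun i _ => hb i ω).trans (by simp))
  -- Along squares the second moments are at most 1 / m², hence summable, so the sum of the `F m` is
  -- almost surely finite and its terms tend to 0.
  let F : ℕ → Ω → ℝ := fun m ω => ((∑ i ∈ Finset.range (m * m), D i ω) / (m * m : ℕ)) ^ 2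
  have hFm : ∀ m, Measurable (F m) := fun m => ((hSm _).div_const _).pow_const _
  have hFi : ∀ m, ∫ ω, F m ω ∂P ≤ 1 / (m : ℝ) ^ 2 := by
    intro m
    simp_rw [F, div_pow]
    rw [integral_div]
    rcases Nat.eq_zero_or_pos m with rfl | h0
    · simp
    have h0 : (0 : ℝ) < m := by exact_mod_cast h0
    rw [div_le_div_iff₀ (by positivity) (by positivity)]
    have := integral_sq_sum_le (P := P) hm hb ho (m * m)
    push_cast at this ⊢
    calc _ ≤ ((m : ℝ) * m) * m ^ 2 := by gcongr
      _ = _ := by ring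
  have hFint : ∀ m, Integrable (F m) P := fun m =>
    Integrable.of_bound (hFm m).aestronglyMeasurable 1 (ae_of_all _ fun ω => by
      rw [Real.norm_eq_abs, abs_pow, abs_div, Nat.abs_cast]
      exact pow_le_one₀ (by positivity) (div_le_one_of_le₀ (hSb _ ω) (by positivity)))
  have hfin : ∫⁻ ω, ∑' m, ENNReal.ofReal (F m ω) ∂P ≠ ⊤ := by
    rw [lintegral_tsum fun m => (hFm m).ennreal_ofReal.aemeasurable]
    simp_rw [← fun m => ofReal_integral_eq_lintegral_ofReal (hFint m)
      (ae_of_all _ fun ω => sq_nonneg _)]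
    refine ne_top_of_le_ne_top ?_
      (ENNReal.tsum_le_tsum fun m => ENNReal.ofReal_le_ofReal (hFi m))
    exact (Real.summable_one_div_nat_pow.2 one_lt_two).tsum_ofReal_ne_top
  have hae := ae_lt_top' (AEMeasurable.tsum fun m =>
    (hFm m).ennreal_ofReal.aemeasurable) hfin
  filter_upwards [hae] with ω hω
  have h0 : Tendsto (fun m => F m ω) atTop (𝓝 0) := by
    have := (ENNReal.tendsto_toReal ENNReal.zero_ne_top).comp
      (ENNReal.tendsto_atTop_zero_of_tsum_ne_top hω.ne)
    refine this.congr fun m => ?_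
    simp only [Function.comp]
    exact ENNReal.toReal_ofReal (sq_nonneg _)
  have h1 : Tendsto (fun m : ℕ => (∑ i ∈ Finset.range (m * m), D i ω) / (m * m : ℕ)) atTop
      (𝓝 0) := by
    rw [tendsto_zero_iff_abs_tendsto_zero]
    have := (Real.continuous_sqrt.tendsto 0).comp h0
    rw [Real.sqrt_zero] at this
    exact this.congr fun m => Real.sqrt_sq_eq_abs _
  -- The distance from n down to the nearest square is at most 2√n, which is o(n).
  refine tendsto_div_of_bounded_steps (K := 1) (t := fun n => Nat.sqrt n * Nat.sqrt n)
    (fun n => ?_) Nat.sqrt_le ?_ (h1.comp tendsto_natSqrt_atTop) ?_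
  · rw [Finset.sum_range_succ, add_sub_cancel_left]
    exact hb n ω
  · filter_upwards [tendsto_natSqrt_atTop.eventually_gt_atTop 0] with n hn
    positivity
  · have h2 : Tendsto (fun n : ℕ => 2 * ((Nat.sqrt n : ℝ))⁻¹) atTop (𝓝 0) := by
      simpa using (tendsto_inv_atTop_zero.comp
        (tendsto_natCast_atTop_atTop.comp tendsto_natSqrt_atTop)).const_mul (2 : ℝ)
    refine squeeze_zero' (Eventually.of_forall fun n => by positivity) ?_ h2
    filter_upwards [tendsto_natSqrt_atTop.eventually_gt_atTop 0] with n hn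
    have hn' : (0 : ℝ) < Nat.sqrt n := by exact_mod_cast hn
    have h3 : ((n - Nat.sqrt n * Nat.sqrt n : ℕ) : ℝ) ≤ 2 * Nat.sqrt n := by
      have := Nat.sqrt_le_add n
      exact_mod_cast (by omega : n - Nat.sqrt n * Nat.sqrt n ≤ 2 * Nat.sqrt n)
    have h4 : (Nat.sqrt n : ℝ) * Nat.sqrt n ≤ n := by exact_mod_cast Nat.sqrt_le n
    calc ((n - Nat.sqrt n * Nat.sqrt n : ℕ) : ℝ) / n
        ≤ 2 * Nat.sqrt n / (Nat.sqrt n * Nat.sqrt n) := by gcongr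
      _ = _ := by field_simp

end StrongLaw

/-! ### Independence and the law of the fair coins -/

section Coins

open ProbabilityTheory

instance : IsProbabilityMeasure uniformSeq := by
  unfold uniformSeq
  infer_instance

theorem ae_lt_one : ∀ᵐ ω ∂uniformSeq, ∀ n, (ω n : ℝ) < 1 := by
  rw [ae_all_iff]
  intro n
  have hm : MeasurePreserving (fun ω : ℕ → unitInterval => ω n) uniformSeq volume :=
    measurePreserving_eval_infinitePi (fun _ : ℕ => (volume : Measure unitInterval)) n
  have h : ∀ᵐ x : unitInterval, x ≠ 1 := by simp [ae_iff]
  filter_upwards [hm.quasiMeasurePreserving.ae h] with ω hω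
  exact lt_of_le_of_ne (ω n).2.2 fun h => hω (Subtype.ext h)

theorem integral_mul_of_dependsOn {N M : ℕ} {f g : (ℕ → unitInterval) → ℝ} (hf : Measurable f)
    (hg : Measurable g) (hfd : DependsOn f (Set.Iio N)) (hgd : DependsOn g (Set.Ico N M)) :
    ∫ ω, f ω * g ω ∂uniformSeq = (∫ ω, f ω ∂uniformSeq) * ∫ ω, g ω ∂uniformSeq := by
  -- Padding with an irrelevant 0 lets a function that depends only on coordinates in `S` factor
  -- through the restriction to `S`, where independence of disjoint finite families applies.
  let ext (S : Finset ℕ) (v : S → unitInterval) (i : ℕ) : unitInterval :=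
    if h : i ∈ S then v ⟨i, h⟩ else 0
  have hext : ∀ S, Measurable (ext S) := fun S => measurable_pi_lambda _ fun i => by
    by_cases h : i ∈ S
    · simpa [ext, h] using measurable_pi_apply _
    · simp [ext, h]
  have hi : iIndepFun (fun i (ω : ℕ → unitInterval) => ω i) uniformSeq :=
    iIndepFun_infinitePi (P := fun _ : ℕ => (volume : Measure unitInterval))
      (X := fun _ x => x) fun _ => measurable_id
  have hST : Disjoint (Finset.range N) (Finset.Ico N M) := by
    rw [Finset.disjoint_left]
    intro i h1 h2
    simp at h1 h2
    omega
  have h := ((hi.indepFun_finset _ _ hST fun i => measurable_pi_apply i).comp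
    (hf.comp (hext _)) (hg.comp (hext _)))
  have ef : (f ∘ ext (Finset.range N)) ∘ (fun (ω : ℕ → unitInterval) (i : Finset.range N) => ω i)
      = f := by
    ext ω
    refine hfd fun i hi => ?_
    have : i ∈ Finset.range N := by simpa using hi
    simp only [ext, dif_pos this]
  have eg : (g ∘ ext (Finset.Ico N M)) ∘ (fun (ω : ℕ → unitInterval) (i : Finset.Ico N M) => ω i)
      = g := by
    ext ω
    refine hgd fun i hi => ?_
    have : i ∈ Finset.Ico N M := by simpa using hi
    simp only [ext, dif_pos this]
  rw [ef, eg] at h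
  exact h.integral_mul_eq_mul_integral hf.aestronglyMeasurable hg.aestronglyMeasurable

theorem measurable_capital (r : ℕ) (ρ : ℝ) (Γ : List Game) (x : ℤ) (n : ℕ) :
    Measurable fun ω => capital r ρ Γ x ω n := by
  induction n with
  | zero => exact measurable_const
  | succ n ih =>
    simp only [capital]
    refine Measurable.ite (measurableSet_lt (by fun_prop) ?_) (ih.add_const 1) (ih.sub_const 1)
    exact (Measurable.of_discrete (f := headsProb r ρ (gameAt Γ n))).comp ih

theorem dependsOn_capital (r : ℕ) (ρ : ℝ) (Γ : List Game) (x : ℤ) (n : ℕ) :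
    DependsOn (fun ω => capital r ρ Γ x ω n) (Set.Iio n) := by
  induction n with
  | zero => exact fun _ _ _ => rfl
  | succ n ih =>
    intro ω ω' h
    have h1 := ih fun i (hi : i < n) => h i (hi.trans n.lt_succ_self)
    have h2 : ω n = ω' n := h n n.lt_succ_self
    simp only at h1
    simp only [capital, h1, h2]

open Classical in
/-- The indicator of the event that all `s` fair coins tossed in a period starting after `N` turns
show tails. -/
noncomputable def allTails (s N : ℕ) (ω : ℕ → unitInterval) : ℝ :=
  if ∀ j < s, 1 / 2 ≤ (ω (N + 2 * j) : ℝ) then 1 else 0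

theorem measurableSet_allTails (s N : ℕ) :
    MeasurableSet {ω : ℕ → unitInterval | ∀ j < s, 1 / 2 ≤ (ω (N + 2 * j) : ℝ)} := by
  simp_rw [Set.ofPred_forall]
  exact MeasurableSet.iInter fun j => MeasurableSet.iInter fun _ =>
    measurableSet_le measurable_const (by fun_prop)

theorem measurable_allTails (s N : ℕ) : Measurable (allTails s N) :=
  Measurable.ite (measurableSet_allTails s N) measurable_const measurable_const

theorem dependsOn_allTails (s N : ℕ) : DependsOn (allTails s N) (Set.Ico N (N + 2 * s)) := by
  intro ω ω' h
  have : ∀ j < s, ω (N + 2 * j) = ω' (N + 2 * j) := fun j hj => h _ ⟨by omega, by omega⟩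
  have h2 : (∀ j < s, 1 / 2 ≤ (ω (N + 2 * j) : ℝ)) ↔ ∀ j < s, 1 / 2 ≤ (ω' (N + 2 * j) : ℝ) :=
    forall₂_congr fun j hj => by rw [this j hj]
  simp only [allTails, h2]

theorem integral_allTails (s N : ℕ) : ∫ ω, allTails s N ω ∂uniformSeq = (1 / 2) ^ s := by
  have h1 : allTails s N =
      {ω : ℕ → unitInterval | ∀ j < s, 1 / 2 ≤ (ω (N + 2 * j) : ℝ)}.indicator 1 := by
    ext ω
    simp [allTails, Set.indicator_apply]
  let S : Finset ℕ := (Finset.range s).image fun j => N + 2 * j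
  let half : unitInterval := ⟨1 / 2, by norm_num, by norm_num⟩
  have h2 : {ω : ℕ → unitInterval | ∀ j < s, 1 / 2 ≤ (ω (N + 2 * j) : ℝ)} =
      Set.pi S fun _ => Set.Ici half := by
    ext ω
    simp [S, Set.mem_pi, half, ← Subtype.coe_le_coe]
  rw [h1, integral_indicator_one (measurableSet_allTails s N), h2, measureReal_def, uniformSeq,
    Measure.infinitePi_pi _ fun _ _ => measurableSet_Ici, Finset.prod_const,
    unitInterval.volume_Ici, Finset.card_image_of_injective _ fun a b h => by simpa using h]
  simp only [half, Finset.card_range, ENNReal.toReal_pow]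
  rw [ENNReal.toReal_ofReal (by norm_num)]
  norm_num

theorem allTails_mem (s N : ℕ) (ω : ℕ → unitInterval) : allTails s N ω = 0 ∨ allTails s N ω = 1 := by
  unfold allTails
  split_ifs <;> simp

end Coins

/-! ### The rate of profit -/

section Rate

open Classical in
/-- The centred indicator that all fair coins of the `k`-th period show tails, on the event that
this period starts at a multiple of `r`. -/
noncomputable def centredTails (r s : ℕ) (x : ℤ) (k : ℕ) (ω : ℕ → unitInterval) : ℝ :=
  if (r : ℤ) ∣ capital r 0 (pattern r s) x ω (k * (2 * s + (r - 2))) then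
    allTails s (k * (2 * s + (r - 2))) ω - (1 / 2) ^ s
  else 0

variable {r s : ℕ} {x : ℤ}

theorem measurableSet_dvd_capital (n : ℕ) :
    MeasurableSet {ω | (r : ℤ) ∣ capital r 0 (pattern r s) x ω n} :=
  measurable_capital r 0 (pattern r s) x n (MeasurableSet.of_discrete (s := {c | (r : ℤ) ∣ c}))

theorem measurable_centredTails (k : ℕ) : Measurable (centredTails r s x k) :=
  Measurable.ite (measurableSet_dvd_capital _) ((measurable_allTails _ _).sub_const _)
    measurable_const

theorem dependsOn_centredTails (k : ℕ) :
    DependsOn (centredTails r s x k) (Set.Iio ((k + 1) * (2 * s + (r - 2)))) := by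
  intro ω ω' h
  have e : (k + 1) * (2 * s + (r - 2)) = k * (2 * s + (r - 2)) + 2 * s + (r - 2) := by ring
  rw [e] at h
  have h1 : capital r 0 (pattern r s) x ω (k * (2 * s + (r - 2))) =
      capital r 0 (pattern r s) x ω' (k * (2 * s + (r - 2))) :=
    dependsOn_capital r 0 (pattern r s) x _ fun i hi => h i (by simp at hi ⊢; omega)
  have h2 := dependsOn_allTails s (k * (2 * s + (r - 2))) (x := ω) (y := ω')
    fun i hi => h i (by simp at hi ⊢; omega)
  simp only [centredTails, h1, h2]

theorem abs_centredTails_le (k : ℕ) (ω : ℕ → unitInterval) : |centredTails r s x k ω| ≤ 1 := by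
  have h0 : (0 : ℝ) ≤ (1 / 2) ^ s := by positivity
  have h1 : ((1 : ℝ) / 2) ^ s ≤ 1 := pow_le_one₀ (by norm_num) (by norm_num)
  unfold centredTails
  split_ifs
  · rcases allTails_mem s (k * (2 * s + (r - 2))) ω with h | h <;> rw [h, abs_le] <;>
      constructor <;> linarith
  · simp

/-- The divisibility test of period j is settled by earlier turns, as is the whole of the i-th
factor. What remains is the centred indicator of the coins of period j, which is independent of that
past and has mean 0. -/
theorem integral_centredTails_mul {i j : ℕ} (hij : i < j) :
    ∫ ω, centredTails r s x i ω * centredTails r s x j ω ∂uniformSeq = 0 := by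
  classical
  let f : (ℕ → unitInterval) → ℝ := fun ω =>
    if (r : ℤ) ∣ capital r 0 (pattern r s) x ω (j * (2 * s + (r - 2))) then
      centredTails r s x i ω else 0
  let g : (ℕ → unitInterval) → ℝ := fun ω => allTails s (j * (2 * s + (r - 2))) ω - (1 / 2) ^ s
  have hfg : ∀ ω, centredTails r s x i ω * centredTails r s x j ω = f ω * g ω := by
    intro ω
    simp only [f, g, centredTails]
    split_ifs <;> simp
  simp_rw [hfg]
  have hf : Measurable f :=
    Measurable.ite (measurableSet_dvd_capital _) (measurable_centredTails _) measurable_const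
  have hg : Measurable g := (measurable_allTails _ _).sub_const _
  have hfd : DependsOn f (Set.Iio (j * (2 * s + (r - 2)))) := by
    intro ω ω' h
    have h1 := dependsOn_capital r 0 (pattern r s) x (j * (2 * s + (r - 2))) h
    have h2 : centredTails r s x i ω = centredTails r s x i ω' := dependsOn_centredTails i
      fun l hl => h l (lt_of_lt_of_le hl (Nat.mul_le_mul_right _ hij))
    simp only at h1
    simp only [f, h1, h2]
  have hgd : DependsOn g (Set.Ico (j * (2 * s + (r - 2))) (j * (2 * s + (r - 2)) + 2 * s)) := by
    intro ω ω' h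
    simp only [g, dependsOn_allTails s _ h]
  have hint : Integrable (allTails s (j * (2 * s + (r - 2)))) uniformSeq :=
    Integrable.of_bound (measurable_allTails _ _).aestronglyMeasurable 1 (ae_of_all _ fun ω => by
      rcases allTails_mem s (j * (2 * s + (r - 2))) ω with h | h <;> simp [h])
  rw [integral_mul_of_dependsOn hf hg hfd hgd, integral_sub hint (integrable_const _),
    integral_allTails]
  simp

/-- If the capital at the ends of the periods, up to a bounded correction `e`, has increments
`m - c * D k` where `D` averages to zero, then the rate of profit is `m` per period. -/
theorem hasRateOfProfit_of_period {m c : ℝ} {e : ℤ → ℝ} {E : ℝ} (hE : ∀ z, |e z| ≤ E) (hr : 3 ≤ r)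
    (h : ∀ ω : ℕ → unitInterval, (∀ n, (ω n : ℝ) < 1) → ∀ k,
      (capital r 0 (pattern r s) x ω ((k + 2) * (2 * s + (r - 2))) : ℝ) +
          e (capital r 0 (pattern r s) x ω ((k + 2) * (2 * s + (r - 2)))) =
        capital r 0 (pattern r s) x ω ((k + 1) * (2 * s + (r - 2))) +
          e (capital r 0 (pattern r s) x ω ((k + 1) * (2 * s + (r - 2)))) +
          m - c * centredTails r s x (k + 1) ω) :
    HasRateOfProfit r 0 (pattern r s) x (m / (2 * s + (r - 2) : ℕ)) := by
  filter_upwards [ae_lt_one, strong_law_of_orthogonal (P := uniformSeq)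
    (fun k => measurable_centredTails (r := r) (s := s) (x := x) k) abs_centredTails_le
    fun i j => integral_centredTails_mul] with ω hω hD
  have h := h ω hω
  set L := 2 * s + (r - 2) with hL
  have hL0 : 0 < L := by omega
  have hL0' : (0 : ℝ) < L := by exact_mod_cast hL0
  set S : ℕ → ℝ := fun n => ∑ i ∈ Finset.range n, centredTails r s x i ω with hS
  set C : ℕ → ℤ := fun n => capital r 0 (pattern r s) x ω n with hC
  have hstep : ∀ k, (C ((k + 1) * L) : ℝ) + e (C ((k + 1) * L)) =
      C (1 * L) + e (C (1 * L)) + k * m - c * (S (k + 1) - S 1) := by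
    intro k
    induction k with
    | zero => simp
    | succ k ih =>
      have hsum : S (k + 1 + 1) = S (k + 1) + centredTails r s x (k + 1) ω :=
        Finset.sum_range_succ _ _
      have hk : (C ((k + 1 + 1) * L) : ℝ) + e (C ((k + 1 + 1) * L)) = C ((k + 1) * L) +
        e (C ((k + 1) * L)) + m - c * centredTails r s x (k + 1) ω := h k
      rw [hk, ih, hsum]
      push_cast
      ring
  have hinv : Tendsto (fun k : ℕ => ((k : ℝ))⁻¹) atTop (𝓝 0) := tendsto_inv_atTop_nhds_zero_nat
  let u : ℕ → ℝ := fun n => C n - x - m / L * n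
  have hper : Tendsto (fun k : ℕ => u (k * L) / k) atTop (𝓝 0) := by
    -- Collects the boundary terms: the first period, which may start at any residue, and the bound
    -- on the correction at the last period end.
    let B : ℝ := |C (1 * L) + e (C (1 * L)) - m + c * S 1 - x| + E
    have hlim : Tendsto (fun k : ℕ => B * (k : ℝ)⁻¹ + |c| * |S k / k|) atTop (𝓝 0) := by
      simpa using (hinv.const_mul B).add (hD.abs.const_mul |c|)
    refine squeeze_zero_norm' ?_ hlim
    filter_upwards [eventually_gt_atTop 0] with k hk
    obtain ⟨k, rfl⟩ := Nat.exists_eq_succ_of_ne_zero hk.ne'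
    simp only [Nat.succ_eq_add_one]
    have hk' : (0 : ℝ) < ((k + 1 : ℕ) : ℝ) := by positivity
    have hu : u ((k + 1) * L) = (C (1 * L) + e (C (1 * L)) - m + c * S 1 - x) -
        e (C ((k + 1) * L)) - c * S (k + 1) := by
      have := hstep k
      have hm : m / L * (((k + 1) * L : ℕ) : ℝ) = m * (k + 1) := by
        push_cast
        field_simp
      simp only [u]
      rw [hm]
      linear_combination this
    rw [Real.norm_eq_abs, abs_div, abs_of_pos hk', hu]
    have hb : |(C (1 * L) + e (C (1 * L)) - m + c * S 1 - x) - e (C ((k + 1) * L)) - c * S (k + 1)|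
        ≤ B + |c| * |S (k + 1)| := by
      rw [← abs_mul]
      refine (abs_sub _ _).trans (add_le_add_left ((abs_sub _ _).trans ?_) _)
      exact add_le_add_right (hE _) _
    calc _ ≤ (B + |c| * |S (k + 1)|) / ((k + 1 : ℕ) : ℝ) := by gcongr
      _ = _ := by rw [abs_div, abs_of_pos hk']; ring
  have hdiv : Tendsto (fun n : ℕ => n / L) atTop atTop := Nat.tendsto_div_const_atTop hL0.ne'
  have hu0 : Tendsto (fun n : ℕ => u n / n) atTop (𝓝 0) := by
    refine tendsto_div_of_bounded_steps (K := 1 + |m / L|) (t := fun n => n / L * L) (fun n => ?_)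
      (fun n => Nat.div_mul_le_self n L) ?_ ?_ ?_
    · have : u (n + 1) - u n = ((C (n + 1) - C n : ℤ) : ℝ) - m / L := by
        simp only [u]
        push_cast
        ring
      rw [this]
      refine (abs_sub _ _).trans (add_le_add_left ?_ _)
      rcases capital_succ_eq_or r 0 (pattern r s) x ω n with h | h <;> simp [hC, h]
    · filter_upwards [hdiv.eventually_gt_atTop 0] with n hn
      positivity
    · have := (hper.comp hdiv).div_const (L : ℝ)
      rw [zero_div] at this
      refine this.congr fun n => ?_
      simp only [Function.comp]
      rw [div_div]
      push_cast
      rfl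
    · have : Tendsto (fun n : ℕ => (L : ℝ) * (n : ℝ)⁻¹) atTop (𝓝 0) := by
        simpa using hinv.const_mul (L : ℝ)
      refine squeeze_zero (fun n => by positivity) (fun n => ?_) this
      rw [← div_eq_mul_inv]
      gcongr
      have h1 := Nat.div_add_mod' n L
      have h2 := Nat.mod_lt n hL0
      omega
  have := hu0.add_const (m / L)
  rw [zero_add] at this
  refine this.congr' ?_
  filter_upwards [eventually_gt_atTop 0] with n hn
  have hn' : (n : ℝ) ≠ 0 := by exact_mod_cast hn.ne'
  simp only [u]
  field_simp
  ring

theorem hasRateOfProfit_even (hr : 3 ≤ r) (hs : 2 * s ≤ r) (heven : Even r) (hx : Even x) :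
    HasRateOfProfit r 0 (pattern r s) x (r * (1 - (1 / 2) ^ s) / (2 * s + (r - 2) : ℕ)) := by
  refine hasRateOfProfit_of_period (c := r) (e := fun _ => 0) (E := 0) (by simp) hr
    fun ω hω k => ?_
  have hd : (r : ℤ) ∣ capital r 0 (pattern r s) x ω ((k + 1) * (2 * s + (r - 2))) :=
    dvd_capital_period_of_even hr heven hx hω k
  rw [capital_period_of_dvd hr hs hω (k + 1) hd, centredTails, if_pos hd, allTails,
    Nat.even_iff.1 heven]
  split_ifs <;> push_cast <;> ring

theorem hasRateOfProfit_odd (hr : 3 ≤ r) (hs : 2 * s ≤ r) (hodd : Odd r) :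
    HasRateOfProfit r 0 (pattern r s) x
      (r * (1 - (1 / 2) ^ s) / (1 + (1 / 2) ^ s) / (2 * s + (r - 2) : ℕ)) := by
  classical
  set m : ℝ := r * (1 - (1 / 2) ^ s) / (1 + (1 / 2) ^ s) with hm
  have hm' : m * (1 + (1 / 2) ^ s) = r * (1 - (1 / 2) ^ s) := by
    rw [hm]
    field_simp
  -- The correction solves the Poisson equation of the two-state chain: from -1 mod r the gain 1
  -- must equal m plus the value 1 - m. From a multiple of r the corrected outcomes are r and -1 +
  -- (1 - m) = -m, whose difference is `c`; centring them at m is the equation `hm'`.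
  refine hasRateOfProfit_of_period (c := m + r) (e := fun z => if (r : ℤ) ∣ z then 0 else 1 - m)
    (E := |1 - m|) (fun z => by split_ifs <;> simp) hr fun ω hω k => ?_
  have hndvd : ∀ {z : ℤ}, (r : ℤ) ∣ z + 1 → ¬ (r : ℤ) ∣ z := fun h h' => by
    have := Int.le_of_dvd one_pos ((Int.dvd_add_right h').1 h)
    omega
  rcases dvd_or_dvd_succ_capital_period (s := s) (x := x) hr hω k with hd | hd
  · rw [capital_period_of_dvd hr hs hω (k + 1) hd, centredTails, if_pos hd, if_pos hd, allTails,
      Nat.odd_iff.1 hodd]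
    split_ifs with h1 h2 h2
    · exact absurd h2 (hndvd (by simpa using hd))
    · push_cast
      linear_combination -hm'
    · push_cast
      linear_combination -hm'
    · exact absurd (dvd_add hd dvd_rfl) h2
  · rw [capital_period_of_dvd_succ hr hodd hω (k + 1) hd, centredTails, if_neg (hndvd hd),
      if_pos hd, if_neg (hndvd hd)]
    push_cast
    ring

end Rate

/-! ### Asymptotics of s_r and of the loss 1 - μ -/

section Asymptotics

theorem sFun_eq (r : ℕ) : sFun r = Nat.log 2 r - 1 := by
  rw [sFun]
  exact congrArg (· - 1) (Real.natFloor_logb_natCast 2 r)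

theorem two_pow_sFun_succ_le {r : ℕ} (hr : 2 ≤ r) : 2 ^ (sFun r + 1) ≤ r := by
  have : 0 < Nat.log 2 r := Nat.log_pos one_lt_two hr
  rw [sFun_eq, Nat.sub_add_cancel this]
  exact Nat.pow_log_le_self 2 (by omega)

theorem lt_two_pow_sFun_add_two (r : ℕ) : r < 2 ^ (sFun r + 2) := by
  refine (Nat.lt_pow_succ_log_self one_lt_two r).trans_le (Nat.pow_le_pow_right two_pos ?_)
  rw [sFun_eq]
  omega

theorem two_mul_sFun_le {r : ℕ} (hr : 2 ≤ r) : 2 * sFun r ≤ r := by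
  have h1 := two_pow_sFun_succ_le hr
  have h2 : sFun r < 2 ^ sFun r := Nat.lt_two_pow_self
  rw [pow_succ] at h1
  omega

theorem tendsto_sFun_atTop : Tendsto sFun atTop atTop := by
  refine tendsto_atTop_atTop.2 fun b => ⟨2 ^ (b + 1), fun r hr => ?_⟩
  have := (Nat.pow_lt_pow_iff_right one_lt_two).1 (hr.trans_lt (lt_two_pow_sFun_add_two r))
  omega

theorem tendsto_half_pow_sFun :
    Tendsto (fun r => ((1 : ℝ) / 2) ^ sFun r) atTop (𝓝 0) :=
  (tendsto_pow_atTop_nhds_zero_of_lt_one (by norm_num) (by norm_num)).comp tendsto_sFun_atTop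

theorem mul_half_pow_sFun_le (r : ℕ) : (r : ℝ) * (1 / 2) ^ sFun r ≤ 4 := by
  have h : (r : ℝ) ≤ 2 ^ (sFun r + 2) := by exact_mod_cast (lt_two_pow_sFun_add_two r).le
  calc (r : ℝ) * (1 / 2) ^ sFun r ≤ 2 ^ (sFun r + 2) * (1 / 2) ^ sFun r := by gcongr
    _ = 4 * (2 * (1 / 2)) ^ sFun r := by rw [mul_pow]; ring
    _ = 4 := by norm_num

theorem tendsto_sFun_div : Tendsto (fun r => (sFun r : ℝ) / r) atTop (𝓝 0) := by
  have h := ((tendsto_pow_const_div_const_pow_of_one_lt 1 (one_lt_two (α := ℝ)))).comp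
    tendsto_sFun_atTop
  refine squeeze_zero' (Eventually.of_forall fun r => by positivity) ?_ h
  filter_upwards [eventually_ge_atTop 2] with r hr
  have h1 : (2 : ℝ) ^ sFun r ≤ r := by
    exact_mod_cast (Nat.pow_le_pow_right two_pos (Nat.le_succ _)).trans (two_pow_sFun_succ_le hr)
  simp only [Function.comp, pow_one]
  gcongr

/-- Since s_r → ∞ the bounded term is negligible in the numerator, and since s_r / r → 0 the
denominator is asymptotic to r. -/
theorem isEquivalent_of_bounded {f b δ : ℕ → ℝ} {K : ℝ} (hb : ∀ᶠ r in atTop, |b r| ≤ K)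
    (hδ : Tendsto δ atTop (𝓝 0))
    (hf : ∀ᶠ r : ℕ in atTop,
      f r = (2 * sFun r + b r) / ((1 + δ r) * (2 * sFun r + (r - 2)))) :
    f ~[atTop] fun r : ℕ => 2 * (sFun r : ℝ) / (r : ℝ) := by
  have hs : Tendsto (fun r => (sFun r : ℝ)) atTop atTop :=
    tendsto_natCast_atTop_atTop.comp tendsto_sFun_atTop
  have hb0 : Tendsto (fun r => b r / (2 * sFun r)) atTop (𝓝 0) := by
    have h : Tendsto (fun r => K / 2 * (sFun r : ℝ)⁻¹) atTop (𝓝 0) := by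
      simpa using (tendsto_inv_atTop_zero.comp hs).const_mul (K / 2)
    refine squeeze_zero_norm' ?_ h
    filter_upwards [hb] with r hr
    rw [Real.norm_eq_abs, abs_div, abs_of_nonneg (by positivity : (0 : ℝ) ≤ 2 * sFun r)]
    calc |b r| / (2 * sFun r) ≤ K / (2 * sFun r) := by gcongr
      _ = _ := by rw [div_mul_eq_div_div]; ring
  have hden : Tendsto (fun r : ℕ => (1 + δ r) * (1 + (2 * ((sFun r : ℝ) / r) - 2 * (r : ℝ)⁻¹)))
      atTop (𝓝 1) := by
    simpa using (hδ.const_add 1).mul (((tendsto_sFun_div.const_mul 2).sub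
      (tendsto_inv_atTop_nhds_zero_nat.const_mul (2 : ℝ))).const_add 1)
  have hlim := (hb0.const_add 1).div hden one_ne_zero
  simp only [add_zero, div_one] at hlim
  rw [isEquivalent_iff_tendsto_one]
  · refine hlim.congr' ?_
    filter_upwards [hf, hs.eventually_gt_atTop 0, eventually_gt_atTop 0] with r h1 h2 h3
    have h3' : (r : ℝ) ≠ 0 := by positivity
    have e1 : 1 + b r / (2 * sFun r) = (2 * sFun r + b r) / (2 * sFun r) := by field_simp
    have e2 : 1 + (2 * ((sFun r : ℝ) / r) - 2 * (r : ℝ)⁻¹) = (2 * sFun r + (r - 2)) / r := by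
      field_simp
      ring
    simp only [Pi.div_apply]
    rw [h1, e1, e2, mul_div_assoc', div_div_div_eq, div_div_div_eq]
    ring
  · filter_upwards [hs.eventually_gt_atTop 0, eventually_gt_atTop 0] with r h2 h3
    have h3' : (r : ℝ) ≠ 0 := by positivity
    positivity

end Asymptotics

end Parrondo

open Parrondo in
theorem corollary6 (x₀ : ℕ → ℤ) (hx₀ : ∀ r : ℕ, 3 ≤ r → Even r → Even (x₀ r)) :
    ∃ μ : ℕ → ℝ,
      (∀ r : ℕ, 3 ≤ r →
        Parrondo.HasRateOfProfit r 0 (Parrondo.pattern r (Parrondo.sFun r)) (x₀ r) (μ r)) ∧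
      (fun r : ℕ => 1 - μ r) ~[atTop] (fun r : ℕ => 2 * (Parrondo.sFun r : ℝ) / (r : ℝ)) := by
  let δ : ℕ → ℝ := fun r => if Even r then 0 else (1 / 2) ^ sFun r
  -- What is left of the numerator of 1 - μ, over the denominator (1 + δ)(2s + r - 2), once 2s is
  -- removed.
  let b : ℕ → ℝ := fun r =>
    if Even r then r * (1 / 2) ^ sFun r - 2
    else (2 * r + 2 * sFun r - 2) * (1 / 2) ^ sFun r - 2
  refine ⟨fun r => r * (1 - (1 / 2) ^ sFun r) / (1 + δ r) / (2 * sFun r + (r - 2) : ℕ), ?_, ?_⟩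
  · intro r hr
    by_cases he : Even r
    · simpa [δ, he] using
        hasRateOfProfit_even hr (two_mul_sFun_le (by omega)) he (hx₀ r hr he)
    · simpa only [δ, he, if_false] using
        hasRateOfProfit_odd hr (two_mul_sFun_le (by omega)) (Nat.not_even_iff_odd.1 he)
  -- The constant 12 comes from 2r + 2s - 2 ≤ 3r together with r · 2^(-s) ≤ 4.
  · refine isEquivalent_of_bounded (b := b) (δ := δ) (K := 12) ?_ ?_ ?_
    · filter_upwards [eventually_ge_atTop 2] with r hr
      have h1 := mul_half_pow_sFun_le r
      have h2 : (2 * sFun r : ℝ) ≤ r := by exact_mod_cast two_mul_sFun_le hr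
      have h3 : (0 : ℝ) < (1 / 2) ^ sFun r := by positivity
      have h4 : (2 : ℝ) ≤ r := by exact_mod_cast hr
      have h5 : (0 : ℝ) ≤ sFun r := by positivity
      have h6 : (2 * r + 2 * sFun r - 2) * (1 / 2 : ℝ) ^ sFun r ≤ 3 * r * (1 / 2) ^ sFun r := by
        gcongr
        linarith
      have h7 : 0 ≤ (2 * r + 2 * sFun r - 2) * (1 / 2 : ℝ) ^ sFun r :=
        mul_nonneg (by linarith) h3.le
      have h8 : 0 ≤ r * (1 / 2 : ℝ) ^ sFun r := by positivity
      simp only [b]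
      split_ifs <;> rw [abs_le] <;> constructor <;> linarith
    · refine squeeze_zero (fun r => ?_) (fun r => ?_) tendsto_half_pow_sFun <;>
        simp only [δ] <;> split_ifs <;> first | positivity | exact le_rfl
    · filter_upwards [eventually_ge_atTop 3] with r hr
      have h3 : (0 : ℝ) < (1 / 2) ^ sFun r := by positivity
      have h4 : (3 : ℝ) ≤ r := by exact_mod_cast hr
      have h5 : (0 : ℝ) ≤ sFun r := by positivity
      have h6 : (0 : ℝ) < 2 * sFun r + (r - 2) := by linarith
      have hδ : 0 < 1 + δ r := by
        simp only [δ]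
        split_ifs <;> positivity
      push_cast [show 2 ≤ r by omega]
      rw [div_div, eq_div_iff (by positivity), sub_mul, div_mul_cancel₀ _ (by positivity)]
      simp only [δ, b]
      split_ifs <;> ring
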